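/- For $n\in\mathbb{N}_0$ let $L_n(x)=\sum_{k=0}^n\binom{n}{n-k}\frac{(-x)^k}{k!}$ be the Laguerre polynomial and $\phi_n(x)=e^{-x}L_n(2x)$ the Laguerre function. For $a\in\mathbb{C}\setminus\mathbb{R}_{\le 0}$ put $$\alpha_{n,1}(a)=\int_0^\infty\frac{e^{-\xi}}{a+\xi}\,\phi_n(\xi)\,d\xi .$$ Then, for every fixed $a\in\mathbb{C}\setminus\mathbb{R}_{\le 0}$, $$\alpha_{n,1}(a)=\exp\!\left(a-2\sqrt{2a(n+1)}\right)\frac{\sqrt\pi}{(2a(n+1))^{1/4}}\left(1+\mathcal{O}\!\left(\frac{1}{\sqrt{n+1}}\right)\right),\qquad n\to\infty,$$ where $\sqrt{z}$ and $z^{1/4}$ denote the principal values for $z\in\mathbb{C}\setminus\mathbb{R}_{\le0}$, and the constant in the $\mathcal{O}$-term may depend on $a$. -/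

import Mathlib

open MeasureTheory Filter Asymptotics

noncomputable section

/-- The Laguerre polynomial `L_n(x) = ∑_{k=0}^n (n choose n-k) (-x)^k / k!`. -/
def laguerreL (n : ℕ) (x : ℝ) : ℝ :=
  ∑ k ∈ Finset.range (n + 1), (n.choose (n - k) : ℝ) * ((-x) ^ k / (k.factorial : ℝ))

/-- The Laguerre function `φ_n(x) = exp(-x) L_n(2x)`. -/
def laguerrePhi (n : ℕ) (x : ℝ) : ℝ :=
  Real.exp (-x) * laguerreL n (2 * x)

/-- `α_{n,k}(a) = ∫₀^∞ exp(-ξ) / (a + ξ)^k · φ_n(ξ) dξ`. -/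
def laguerreAlpha (n k : ℕ) (a : ℂ) : ℂ :=
  ∫ ξ in Set.Ioi (0 : ℝ), (Real.exp (-ξ) : ℂ) / (a + (ξ : ℂ)) ^ k * (laguerrePhi n ξ : ℂ)

end

/-! Put `w = √(2a)`, so `Re w > 0`, and `N = n + 1`. Substituting `x = 2ξ`, the integral becomes the
Stieltjes transform of `exp(-x) L_n(x)` at `w ^ 2`. Writing `1 / (w ^ 2 + x)` as a Laplace integral
turns it into `∫ exp(-ws) s^n / (w + s)^(n+1) ds` (`integral_exp_neg_mul_laguerreL_div`). Expanding
the rational factor as a gamma integral gives the mean of `2 K_0(2w√t)` against the gamma density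
`t^n exp(-t) / n!` (`integral_cexp_mul_pow_div`).

Laplace's method gives `2 K_0(2w√t) ≈ exp(-2w√t) √(π / (w√t))` (`norm_bessel_sub_le`). The density
concentrates around `N` at scale `√N`, where `2√t ≈ 2√N + (t - N)/√N`. Hence, after multiplication
by `exp(2w√N) √(w√N / π)`, the kernel is close to `exp(-w(t - N)/√N)`, with error `O(1/√N)` times a
weight (`norm_normalized_bessel_sub_le`) whose gamma mean is bounded in `n`
(`integral_gamma_mul_weight_le`). The gamma mean of that exponential is explicit and equals
`exp(w²/2) = exp a` up to `O(1/√N)` (`isBigO_cexp_div_one_add_pow_sub`). -/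

/-! ### Gamma integrals with a complex rate. -/

theorem norm_pow_mul_cexp_neg_mul (b : ℂ) (k : ℕ) {t : ℝ} (ht : 0 ≤ t) :
    ‖(t : ℂ) ^ k * Complex.exp (-(b * t))‖ = t ^ k * Real.exp (-(b.re * t)) := by
  simp [Complex.norm_exp, abs_of_nonneg ht]

theorem integrableOn_pow_mul_exp_neg_mul {b : ℝ} (hb : 0 < b) (k : ℕ) :
    IntegrableOn (fun t : ℝ => t ^ k * Real.exp (-(b * t))) (Set.Ioi 0) := by
  have := integrableOn_rpow_mul_exp_neg_mul_rpow (p := 1) (s := k) (b := b)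
    (by have : (0 : ℝ) ≤ k := k.cast_nonneg
        linarith) one_pos hb
  simpa using this

theorem integrableOn_pow_mul_cexp_neg_mul {b : ℂ} (hb : 0 < b.re) (k : ℕ) :
    IntegrableOn (fun t : ℝ => (t : ℂ) ^ k * Complex.exp (-(b * t))) (Set.Ioi 0) := by
  refine (integrableOn_pow_mul_exp_neg_mul hb k).mono' (by fun_prop) ?_
  filter_upwards [ae_restrict_mem measurableSet_Ioi] with t ht
  exact (norm_pow_mul_cexp_neg_mul b k (le_of_lt ht)).le

theorem integral_pow_mul_cexp_neg_mul {b : ℂ} (hb : 0 < b.re) (k : ℕ) :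
    ∫ t in Set.Ioi (0 : ℝ), (t : ℂ) ^ k * Complex.exp (-(b * t)) = k.factorial / b ^ (k + 1) := by
  have hb0 : b ≠ 0 := by
    rintro rfl
    simp at hb
  induction k with
  | zero =>
    have := integral_exp_mul_complex_Ioi (a := -b) (by simpa using hb) 0
    simpa [neg_div_neg_eq] using this
  | succ k ih =>
    have hd : ∀ t ∈ Set.Ici (0 : ℝ), HasDerivAt
        (fun t : ℝ => (t : ℂ) ^ (k + 1) * Complex.exp (-(b * t)))
        ((k + 1) * ((t : ℂ) ^ k * Complex.exp (-(b * t))) -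
          b * ((t : ℂ) ^ (k + 1) * Complex.exp (-(b * t)))) t := by
      intro t _
      have h1 : HasDerivAt (fun z : ℂ => z ^ (k + 1) * Complex.exp (-(b * z)))
          ((k + 1) * ((t : ℂ) ^ k * Complex.exp (-(b * t))) -
          b * ((t : ℂ) ^ (k + 1) * Complex.exp (-(b * t)))) (t : ℂ) := by
        have h2 := (hasDerivAt_pow (k + 1) (t : ℂ)).mul
          ((((hasDerivAt_id (t : ℂ)).const_mul b).neg).cexp)
        refine h2.congr_deriv ?_
        simp
        ring
      exact h1.comp_ofReal
    have hi := (((integrableOn_pow_mul_cexp_neg_mul hb k).const_mul (k + 1 : ℂ)).sub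
      ((integrableOn_pow_mul_cexp_neg_mul hb (k + 1)).const_mul b))
    have hl : Tendsto (fun t : ℝ => (t : ℂ) ^ (k + 1) * Complex.exp (-(b * t))) atTop (nhds 0) := by
      rw [tendsto_zero_iff_norm_tendsto_zero]
      have := tendsto_rpow_mul_exp_neg_mul_atTop_nhds_zero (k + 1 : ℕ) b.re hb
      refine this.congr' ?_
      filter_upwards [eventually_ge_atTop 0] with t ht
      rw [norm_pow_mul_cexp_neg_mul b _ ht, Real.rpow_natCast, neg_mul]
    have h3 := integral_Ioi_of_hasDerivAt_of_tendsto' hd hi hl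
    rw [integral_sub ((integrableOn_pow_mul_cexp_neg_mul hb k).const_mul _)
      ((integrableOn_pow_mul_cexp_neg_mul hb (k + 1)).const_mul b), integral_const_mul,
      integral_const_mul, ih] at h3
    have h4 : b * ∫ t in Set.Ioi (0 : ℝ), (t : ℂ) ^ (k + 1) * Complex.exp (-(b * t)) =
        (k + 1) * (k.factorial / b ^ (k + 1)) := by
      simp at h3
      linear_combination -h3
    rw [eq_div_iff (pow_ne_zero _ hb0), pow_succ' b (k + 1), ← mul_assoc, mul_comm _ b, h4,
      Nat.factorial_succ]
    push_cast
    field_simp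

theorem integral_pow_mul_exp_neg_mul {b : ℝ} (hb : 0 < b) (k : ℕ) :
    ∫ t in Set.Ioi (0 : ℝ), t ^ k * Real.exp (-(b * t)) = k.factorial / b ^ (k + 1) := by
  have := integral_pow_mul_cexp_neg_mul (b := (b : ℂ)) (by simpa using hb) k
  have h2 : ∫ t in Set.Ioi (0 : ℝ), (t : ℂ) ^ k * Complex.exp (-(b * t)) =
      ((∫ t in Set.Ioi (0 : ℝ), t ^ k * Real.exp (-(b * t)) : ℝ) : ℂ) := by
    rw [← integral_complex_ofReal]
    push_cast
    rfl
  rw [h2] at this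
  exact_mod_cast this

/-! ### Laguerre functions: Laplace and Stieltjes transforms. -/

theorem exp_neg_mul_laguerreL (n : ℕ) (x : ℝ) :
    ((Real.exp (-x) * laguerreL n x : ℝ) : ℂ) = ∑ k ∈ Finset.range (n + 1),
      ((n.choose k : ℂ) * (-1) ^ k / k.factorial) * ((x : ℂ) ^ k * Complex.exp (-(1 * x))) := by
  rw [laguerreL, Finset.mul_sum]
  push_cast
  refine Finset.sum_congr rfl fun k hk => ?_
  rw [Nat.choose_symm (Nat.lt_succ_iff.mp (Finset.mem_range.mp hk)), neg_pow, one_mul]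
  ring

theorem integrableOn_exp_neg_mul_laguerreL (n : ℕ) :
    IntegrableOn (fun x : ℝ => ((Real.exp (-x) * laguerreL n x : ℝ) : ℂ)) (Set.Ioi 0) := by
  simp_rw [exp_neg_mul_laguerreL]
  exact integrable_finsetSum _ fun k _ =>
    (integrableOn_pow_mul_cexp_neg_mul (b := 1) (by simp) k).const_mul _

/-- The Laplace transform of `x ↦ exp(-x) L_n(x)`. -/
theorem integral_exp_neg_mul_laguerreL_mul_cexp (n : ℕ) {q : ℂ} (hq : 0 ≤ q.re) :
    ∫ x in Set.Ioi (0 : ℝ), ((Real.exp (-x) * laguerreL n x : ℝ) : ℂ) * Complex.exp (-(q * x)) =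
      q ^ n / (1 + q) ^ (n + 1) := by
  have hb : 0 < (1 + q).re := by
    simp
    linarith
  have hb0 : 1 + q ≠ 0 := by
    intro h
    simp [h] at hb
  have h1 : ∀ x : ℝ, ((Real.exp (-x) * laguerreL n x : ℝ) : ℂ) * Complex.exp (-(q * x)) =
      ∑ k ∈ Finset.range (n + 1), ((n.choose k : ℂ) * (-1) ^ k / k.factorial) *
        ((x : ℂ) ^ k * Complex.exp (-((1 + q) * x))) := by
    intro x
    rw [exp_neg_mul_laguerreL, Finset.sum_mul]
    refine Finset.sum_congr rfl fun k _ => ?_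
    rw [add_mul, neg_add, Complex.exp_add]
    ring
  simp_rw [h1]
  rw [integral_finsetSum _ fun k _ => (integrableOn_pow_mul_cexp_neg_mul hb k).const_mul _]
  simp_rw [integral_const_mul, integral_pow_mul_cexp_neg_mul hb]
  have h2 : q = -1 + (1 + q) := by ring
  conv_rhs => rw [h2, add_pow, ← h2, Finset.sum_div]
  refine Finset.sum_congr rfl fun k hk => ?_
  have hk' := Nat.lt_succ_iff.mp (Finset.mem_range.mp hk)
  have h3 : (1 + q) ^ (n + 1) = (1 + q) ^ (n - k) * (1 + q) ^ (k + 1) := by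
    rw [← pow_add]
    congr 1
    omega
  have : (k.factorial : ℂ) ≠ 0 := by exact_mod_cast k.factorial_ne_zero
  rw [h3]
  field_simp

theorem laguerreAlpha_one_eq (n : ℕ) (a : ℂ) :
    laguerreAlpha n 1 a =
      ∫ x in Set.Ioi (0 : ℝ), ((Real.exp (-x) * laguerreL n x : ℝ) : ℂ) / (2 * a + x) := by
  have h := integral_comp_mul_left_Ioi
    (fun x : ℝ => ((Real.exp (-x) * laguerreL n x : ℝ) : ℂ) / (2 * a + x)) 0
    (b := 2) two_pos
  rw [mul_zero] at h
  have h' : ∫ x in Set.Ioi (0 : ℝ), ((Real.exp (-x) * laguerreL n x : ℝ) : ℂ) / (2 * a + x) =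
      2 * ∫ x in Set.Ioi (0 : ℝ), ((Real.exp (-(2 * x)) * laguerreL n (2 * x) : ℝ) : ℂ) /
        (2 * a + (2 * x : ℝ)) := by
    rw [h]
    simp
  rw [h', ← integral_const_mul, laguerreAlpha]
  congr 1
  ext ξ
  have : Real.exp (-(2 * ξ)) = Real.exp (-ξ) * Real.exp (-ξ) := by
    rw [← Real.exp_add]
    ring_nf
  rw [laguerrePhi, this]
  push_cast
  rw [← mul_add, pow_one]
  -- `a` is arbitrary here, so the denominator may vanish; both sides are then `0` by the convention
  -- for division by zero.
  rcases eq_or_ne (a + (ξ : ℂ)) 0 with h0 | h0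
  · simp [h0]
  · field_simp

/-- Rotating the ray of integration turns the Stieltjes transform of `x ↦ exp(-x) L_n(x)` at `w ^ 2`
into a Laplace transform at `w`. -/
theorem integral_exp_neg_mul_laguerreL_div (n : ℕ) {w : ℂ} (hw : 0 < w.re) :
    ∫ x in Set.Ioi (0 : ℝ), ((Real.exp (-x) * laguerreL n x : ℝ) : ℂ) / (w ^ 2 + x) =
      ∫ s in Set.Ioi (0 : ℝ), Complex.exp (-(w * s)) * ((s : ℂ) ^ n / (w + s) ^ (n + 1)) := by
  have hw0 : w ≠ 0 := by
    rintro rfl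
    simp at hw
  have hwi : 0 ≤ (w⁻¹).re := by
    rw [Complex.inv_re]
    exact div_nonneg hw.le (Complex.normSq_nonneg w)
  -- `1 / (w ^ 2 + x) = w⁻¹ ∫ exp(-(w + x/w)s) ds`, which converges because `Re w` is positive and
  -- `Re w⁻¹` nonnegative.
  have h1 : ∀ x ∈ Set.Ioi (0 : ℝ), ((Real.exp (-x) * laguerreL n x : ℝ) : ℂ) / (w ^ 2 + x) =
      ∫ s in Set.Ioi (0 : ℝ), ((Real.exp (-x) * laguerreL n x : ℝ) : ℂ) *
        (Complex.exp (-(w * s)) * Complex.exp (-(s / w * x)) / w) := by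
    intro x hx
    have hre : 0 < (w + x / w).re := by
      rw [div_eq_mul_inv, Complex.add_re, Complex.re_ofReal_mul]
      have := mul_nonneg (le_of_lt hx) hwi
      linarith
    have hne : w + x / w ≠ 0 := by
      intro h
      simp [h] at hre
    have h2 := integral_pow_mul_cexp_neg_mul hre 0
    simp only [pow_zero, one_mul, Nat.factorial_zero, Nat.cast_one, zero_add, pow_one] at h2
    have h3 : ∀ s : ℝ, Complex.exp (-(w * s)) * Complex.exp (-(s / w * x)) / w =
        Complex.exp (-((w + x / w) * s)) * w⁻¹ := by
      intro s
      rw [← Complex.exp_add, div_eq_mul_inv _ w]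
      congr 2
      ring
    simp_rw [h3]
    rw [integral_const_mul, integral_mul_const, h2, div_eq_mul_inv]
    congr 1
    rw [one_div, ← mul_inv]
    congr 1
    field_simp
  rw [setIntegral_congr_fun measurableSet_Ioi h1, integral_integral_swap]
  · refine setIntegral_congr_fun measurableSet_Ioi fun s hs => ?_
    have h4 : ∀ x : ℝ, ((Real.exp (-x) * laguerreL n x : ℝ) : ℂ) *
        (Complex.exp (-(w * s)) * Complex.exp (-(s / w * x)) / w) =
        (Complex.exp (-(w * s)) / w) * (((Real.exp (-x) * laguerreL n x : ℝ) : ℂ) *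
          Complex.exp (-(s / w * x))) := fun x => by ring
    have hq : 0 ≤ ((s : ℂ) / w).re := by
      rw [div_eq_mul_inv, Complex.re_ofReal_mul]
      exact mul_nonneg (le_of_lt hs) hwi
    have hws : w + s ≠ 0 := by
      intro h
      have := congrArg Complex.re h
      have hs' : 0 < s := hs
      simp at this
      linarith
    simp_rw [h4]
    rw [integral_const_mul, integral_exp_neg_mul_laguerreL_mul_cexp n hq]
    have : 1 + (s : ℂ) / w = (w + s) / w := by field_simp
    rw [this, div_pow, div_pow]
    field_simp
    ring
  -- Fubini: `|exp(-sx/w)| ≤ 1`, so the integrand is dominated by a product of a function of `x` and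
  -- a function of `s`.
  · have hI := (integrableOn_exp_neg_mul_laguerreL n).norm.mul_prod
      ((integrableOn_pow_mul_exp_neg_mul hw 0).mul_const ‖w‖⁻¹)
    refine hI.mono' ?_ ?_
    · apply Measurable.aestronglyMeasurable
      unfold laguerreL
      fun_prop
    · rw [Measure.prod_restrict]
      filter_upwards [ae_restrict_mem (measurableSet_Ioi.prod measurableSet_Ioi)] with p hp
      have hp1 : 0 < p.1 := hp.1
      have hp2 : 0 < p.2 := hp.2
      simp only [Function.uncurry, norm_mul, norm_div, pow_zero, one_mul]
      gcongr
      rw [div_eq_mul_inv]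
      gcongr
      have e1 : ‖Complex.exp (-(w * p.2))‖ = Real.exp (-(w.re * p.2)) := by
        simp [Complex.norm_exp]
      have e2 : ‖Complex.exp (-(p.2 / w * p.1))‖ ≤ 1 := by
        rw [Complex.norm_exp, Real.exp_le_one_iff, Complex.neg_re, Complex.re_mul_ofReal,
          div_eq_mul_inv, Complex.re_ofReal_mul]
        have : 0 ≤ p.2 * (w⁻¹).re * p.1 := by positivity
        linarith
      rw [e1]
      exact mul_le_of_le_one_right (Real.exp_pos _).le e2

/-! ### The Laplace integral as a gamma mean of Bessel functions. -/

theorem integrable_cexp_mul_gammaKernel (n : ℕ) {w : ℂ} (hw : 0 < w.re) :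
    Integrable (Function.uncurry fun s t : ℝ => Complex.exp (-(w * s)) / s *
      ((t : ℂ) ^ n * Complex.exp (-((1 + w / s) * t))))
      ((volume.restrict (Set.Ioi 0)).prod (volume.restrict (Set.Ioi 0))) := by
  have hre : ∀ s : ℝ, 0 < s → (1 + w / s).re = 1 + w.re / s := fun s _ => by
    rw [Complex.add_re, Complex.div_ofReal_re, Complex.one_re]
  have hpos : ∀ s : ℝ, 0 < s → 0 < 1 + w.re / s := fun s hs => by positivity
  rw [integrable_prod_iff]
  · constructor
    · filter_upwards [ae_restrict_mem measurableSet_Ioi] with s hs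
      simp only [Function.uncurry]
      exact (integrableOn_pow_mul_cexp_neg_mul (by rw [hre s hs]; exact hpos s hs) n).const_mul _
    · have hI := (integrableOn_pow_mul_exp_neg_mul hw 0).const_mul (n.factorial / w.re)
      refine hI.mono' ?_ ?_
      · refine AEStronglyMeasurable.norm (?_ : AEStronglyMeasurable _ _) |>.integral_prod_right'
        apply Measurable.aestronglyMeasurable
        fun_prop
      · filter_upwards [ae_restrict_mem measurableSet_Ioi] with s hs
        have hs' : 0 < s := hs
        have h1 : ∫ t in Set.Ioi (0 : ℝ), ‖Function.uncurry (fun s t : ℝ =>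
            Complex.exp (-(w * s)) / s *
            ((t : ℂ) ^ n * Complex.exp (-((1 + w / s) * t)))) (s, t)‖ =
            Real.exp (-(w.re * s)) / s * (n.factorial / (1 + w.re / s) ^ (n + 1)) := by
          rw [← integral_pow_mul_exp_neg_mul (hpos s hs) n, ← integral_const_mul]
          refine setIntegral_congr_fun measurableSet_Ioi fun t ht => ?_
          simp only [Function.uncurry]
          rw [norm_mul, norm_pow_mul_cexp_neg_mul _ _ (le_of_lt ht), hre s hs, norm_div,
            Complex.norm_exp, Complex.norm_real, Real.norm_of_nonneg hs'.le]
          simp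
        rw [h1, Real.norm_of_nonneg (by have := hpos s hs; positivity)]
        -- This absorbs the singular factor `1 / s` at the origin.
        have h2 : w.re / s ≤ (1 + w.re / s) ^ (n + 1) := by
          have : 1 + w.re / s ≤ (1 + w.re / s) ^ (n + 1) :=
            le_self_pow₀ (by have : 0 < w.re / s := by positivity
                             linarith) (by omega)
          linarith
        calc Real.exp (-(w.re * s)) / s * (n.factorial / (1 + w.re / s) ^ (n + 1))
            ≤ Real.exp (-(w.re * s)) / s * (n.factorial / (w.re / s)) := by gcongr
          _ = n.factorial / w.re * (s ^ 0 * Real.exp (-(w.re * s))) := by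
            field_simp
  · apply Measurable.aestronglyMeasurable
    fun_prop

theorem cexp_mul_gammaKernel_eq (n : ℕ) (w : ℂ) (s t : ℝ) :
    Complex.exp (-(w * s)) / s * ((t : ℂ) ^ n * Complex.exp (-((1 + w / s) * t))) =
      ((t ^ n * Real.exp (-t) : ℝ) : ℂ) * (Complex.exp (-(w * (s + t / s))) / s) := by
  have : Complex.exp (-(w * s)) * Complex.exp (-((1 + w / s) * t)) =
      Complex.exp (-t) * Complex.exp (-(w * (s + t / s))) := by
    rw [← Complex.exp_add, ← Complex.exp_add]
    congr 1
    ring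
  push_cast
  linear_combination (t : ℂ) ^ n / s * this

theorem integrableOn_pow_mul_exp_neg_mul_bessel (n : ℕ) {w : ℂ} (hw : 0 < w.re) :
    IntegrableOn (fun t : ℝ => ((t ^ n * Real.exp (-t) : ℝ) : ℂ) *
      ∫ s in Set.Ioi (0 : ℝ), Complex.exp (-(w * (s + t / s))) / s) (Set.Ioi 0) := by
  have h := (integrable_cexp_mul_gammaKernel n hw).integral_prod_right
  refine h.congr (ae_of_all _ fun t => ?_)
  simp_rw [Function.uncurry, cexp_mul_gammaKernel_eq, integral_const_mul]

/-- `s^n / (w + s)^(n+1) = s⁻¹ (1 + w/s)^(-(n+1))`, and the last power is a gamma integral with rate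
`1 + w/s`; then swap the integrals. -/
theorem integral_cexp_mul_pow_div (n : ℕ) {w : ℂ} (hw : 0 < w.re) :
    ∫ s in Set.Ioi (0 : ℝ), Complex.exp (-(w * s)) * ((s : ℂ) ^ n / (w + s) ^ (n + 1)) =
      (∫ t in Set.Ioi (0 : ℝ), ((t ^ n * Real.exp (-t) : ℝ) : ℂ) *
        ∫ s in Set.Ioi (0 : ℝ), Complex.exp (-(w * (s + t / s))) / s) / n.factorial := by
  have hn : (n.factorial : ℂ) ≠ 0 := by exact_mod_cast n.factorial_ne_zero
  rw [eq_div_iff hn, ← integral_mul_const]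
  have h := integral_integral_swap (integrable_cexp_mul_gammaKernel n hw)
  simp_rw [cexp_mul_gammaKernel_eq, integral_const_mul] at h
  rw [← h]
  refine setIntegral_congr_fun measurableSet_Ioi fun s hs => ?_
  have hs' : 0 < s := hs
  have hre : 0 < (1 + w / s).re := by
    rw [Complex.add_re, Complex.div_ofReal_re, Complex.one_re]
    positivity
  have hs0 : (s : ℂ) ≠ 0 := by exact_mod_cast hs'.ne'
  have hws : w + s ≠ 0 := by
    intro h
    have := congrArg Complex.re h
    simp at this
    linarith
  have h2 : 1 + w / (s : ℂ) = (w + s) / s := by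
    field_simp
    ring
  simp_rw [← cexp_mul_gammaKernel_eq]
  rw [integral_const_mul, integral_pow_mul_cexp_neg_mul hre, h2, div_pow]
  field_simp
  ring

/-! ### Laplace's method for the Bessel kernel. -/

theorem image_mul_exp_two_mul_arsinh {τ : ℝ} (hτ : 0 < τ) :
    (fun p : ℝ => τ * Real.exp (2 * Real.arsinh (p / 2))) '' Set.univ = Set.Ioi 0 := by
  ext s
  simp only [Set.image_univ, Set.mem_range, Set.mem_Ioi]
  constructor
  · rintro ⟨p, rfl⟩
    positivity
  · intro hs
    refine ⟨2 * Real.sinh (Real.log (s / τ) / 2), ?_⟩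
    rw [mul_div_cancel_left₀ _ two_ne_zero, Real.arsinh_sinh, mul_div_cancel₀ _ two_ne_zero,
      Real.exp_log (by positivity)]
    field_simp

theorem exp_two_mul_arsinh_add_inv (p : ℝ) :
    Real.exp (2 * Real.arsinh (p / 2)) + (Real.exp (2 * Real.arsinh (p / 2)))⁻¹ = 2 + p ^ 2 := by
  have h1 := Real.cosh_two_mul (Real.arsinh (p / 2))
  rw [Real.cosh_sq, Real.sinh_arsinh, Real.cosh_eq] at h1
  rw [← Real.exp_neg]
  linarith

/-- A form of the modified Bessel function `2 K_0(2wτ)` to which Laplace's method applies. -/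
theorem integral_cexp_add_div_eq (w : ℂ) {τ : ℝ} (hτ : 0 < τ) :
    ∫ s in Set.Ioi (0 : ℝ), Complex.exp (-(w * (s + (τ ^ 2 : ℝ) / s))) / s =
      ∫ p : ℝ, (((√(1 + (p / 2) ^ 2))⁻¹ : ℝ) : ℂ) * Complex.exp (-(w * τ * (2 + p ^ 2))) := by
  -- The substitution is `s = τ exp(2u)` with `p = 2 sinh u`: then `s + τ²/s = τ(2 + p²)` and `ds/s
  -- = dp / √(1 + p²/4)`.
  have hd : ∀ p ∈ Set.univ, HasDerivWithinAt
      (fun p : ℝ => τ * Real.exp (2 * Real.arsinh (p / 2)))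
      (τ * Real.exp (2 * Real.arsinh (p / 2)) * (√(1 + (p / 2) ^ 2))⁻¹) Set.univ p := by
    intro p _
    have h1 : HasDerivAt (fun p : ℝ => p / 2) (1 / 2) p := (hasDerivAt_id p).div_const 2
    have h2 := ((((Real.hasDerivAt_arsinh (p / 2)).comp p h1).const_mul 2).exp.const_mul τ)
    refine (h2.congr_deriv ?_).hasDerivWithinAt
    simp only [Function.comp]
    ring
  have hinj : Set.InjOn (fun p : ℝ => τ * Real.exp (2 * Real.arsinh (p / 2))) Set.univ := by
    intro p _ q _ h
    have h1 := Real.exp_injective (mul_left_cancel₀ hτ.ne' h)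
    have h2 := Real.arsinh_injective (mul_left_cancel₀ two_ne_zero h1)
    linarith
  have h := integral_image_eq_integral_abs_deriv_smul MeasurableSet.univ hd hinj
    (fun s : ℝ => Complex.exp (-(w * (s + (τ ^ 2 : ℝ) / s))) / s)
  rw [image_mul_exp_two_mul_arsinh hτ, setIntegral_univ] at h
  rw [h]
  congr 1
  ext p
  set E := Real.exp (2 * Real.arsinh (p / 2)) with hE
  have hE0 : 0 < E := Real.exp_pos _
  have h3 : τ * E + τ ^ 2 / (τ * E) = τ * (2 + p ^ 2) := by
    rw [← exp_two_mul_arsinh_add_inv p, ← hE]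
    field_simp
  have h4 : -(w * (((τ * E : ℝ) : ℂ) + ((τ ^ 2 : ℝ) : ℂ) / ((τ * E : ℝ) : ℂ))) =
      -(w * τ * (2 + p ^ 2)) := by
    rw [← Complex.ofReal_div, ← Complex.ofReal_add, h3]
    push_cast
    ring
  rw [h4, abs_of_pos (by positivity), Complex.real_smul]
  have hE1 : (E : ℂ) ≠ 0 := by exact_mod_cast hE0.ne'
  have hτ1 : (τ : ℂ) ≠ 0 := by exact_mod_cast hτ.ne'
  push_cast
  field_simp

theorem abs_inv_sqrt_one_add_sub_one_le {y : ℝ} (hy : 0 ≤ y) : |(√(1 + y))⁻¹ - 1| ≤ y / 2 := by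
  have h1 : 1 ≤ √(1 + y) := Real.one_le_sqrt.mpr (by linarith)
  have h2 : √(1 + y) ^ 2 = 1 + y := Real.sq_sqrt (by linarith)
  rw [abs_sub_comm, abs_of_nonneg (sub_nonneg.mpr (inv_le_one_of_one_le₀ h1))]
  rw [← sub_nonneg]
  have : y / 2 - (1 - (√(1 + y))⁻¹) = (√(1 + y) - 1) ^ 2 * (√(1 + y) + 2) / (2 * √(1 + y)) := by
    have : y = √(1 + y) ^ 2 - 1 := by linarith
    rw [eq_div_iff (by positivity)]
    have h3 : (√(1 + y))⁻¹ * √(1 + y) = 1 := inv_mul_cancel₀ (by positivity)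
    linear_combination 2 * h3 + √(1 + y) * this
  rw [this]
  positivity

theorem sq_mul_exp_neg_mul_sq_le {b : ℝ} (hb : 0 < b) (p : ℝ) :
    p ^ 2 * Real.exp (-b * p ^ 2) ≤ 2 / b * Real.exp (-(b / 2) * p ^ 2) := by
  have h1 : b / 2 * p ^ 2 ≤ Real.exp (b / 2 * p ^ 2) := by
    linarith [Real.add_one_le_exp (b / 2 * p ^ 2)]
  have h2 : Real.exp (-b * p ^ 2) * Real.exp (b / 2 * p ^ 2) = Real.exp (-(b / 2) * p ^ 2) := by
    rw [← Real.exp_add]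
    ring_nf
  calc p ^ 2 * Real.exp (-b * p ^ 2) = 2 / b * (Real.exp (-b * p ^ 2) * (b / 2 * p ^ 2)) := by
        field_simp
    _ ≤ 2 / b * (Real.exp (-b * p ^ 2) * Real.exp (b / 2 * p ^ 2)) := by gcongr
    _ = _ := by rw [h2]

/-- Replacing `1 / √(1 + p²/4)` by `1` leaves an exact Gaussian integral. The replacement costs at
most `p²/8`, which half of the Gaussian decay absorbs. -/
theorem norm_bessel_sub_le {w : ℂ} (hw : 0 < w.re) {τ : ℝ} (hτ : 0 < τ) :
    ‖(∫ s in Set.Ioi (0 : ℝ), Complex.exp (-(w * (s + (τ ^ 2 : ℝ) / s))) / s) -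
      Complex.exp (-(2 * w * τ)) * (Real.pi / (w * τ)) ^ (1 / 2 : ℂ)‖ ≤
      Real.exp (-(2 * w.re * τ)) * (1 / (4 * (w.re * τ)) * √(2 * Real.pi / (w.re * τ))) := by
  have hre : (w * τ).re = w.re * τ := by simp
  have hb : 0 < w.re * τ := by positivity
  have hbc : 0 < (w * τ).re := hre ▸ hb
  have hfac : ∀ p : ℝ, Complex.exp (-(w * τ * (2 + p ^ 2))) =
      Complex.exp (-(2 * w * τ)) * Complex.exp (-(w * τ) * p ^ 2) := fun p => by
    rw [← Complex.exp_add]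
    ring_nf
  have hnorm : ∀ p : ℝ, ‖Complex.exp (-(w * τ) * (p : ℂ) ^ 2)‖ =
      Real.exp (-(w.re * τ) * p ^ 2) := fun p => by
    rw [Complex.norm_exp, ← Complex.ofReal_pow, Complex.re_mul_ofReal, Complex.neg_re, hre]
  have hbound : ∀ p : ℝ, ‖((((√(1 + (p / 2) ^ 2))⁻¹ : ℝ) : ℂ) - 1) *
      Complex.exp (-(w * τ) * p ^ 2)‖ ≤
      1 / (4 * (w.re * τ)) * Real.exp (-(w.re * τ / 2) * p ^ 2) := by
    intro p
    rw [norm_mul, hnorm, ← Complex.ofReal_one, ← Complex.ofReal_sub, Complex.norm_real,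
      Real.norm_eq_abs]
    calc |(√(1 + (p / 2) ^ 2))⁻¹ - 1| * Real.exp (-(w.re * τ) * p ^ 2)
        ≤ (p / 2) ^ 2 / 2 * Real.exp (-(w.re * τ) * p ^ 2) := by
          gcongr
          exact abs_inv_sqrt_one_add_sub_one_le (sq_nonneg _)
      _ = 1 / 8 * (p ^ 2 * Real.exp (-(w.re * τ) * p ^ 2)) := by ring
      _ ≤ 1 / 8 * (2 / (w.re * τ) * Real.exp (-(w.re * τ / 2) * p ^ 2)) := by
          gcongr 1 / 8 * ?_
          exact sq_mul_exp_neg_mul_sq_le hb p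
      _ = _ := by
          field_simp
          norm_num
  have hint0 := integrable_cexp_neg_mul_sq hbc
  have hint1 : Integrable fun p : ℝ => 1 / (4 * (w.re * τ)) * Real.exp (-(w.re * τ / 2) * p ^ 2) :=
    (integrable_exp_neg_mul_sq (half_pos hb)).const_mul _
  have hint2 : Integrable fun p : ℝ => ((((√(1 + (p / 2) ^ 2))⁻¹ : ℝ) : ℂ) - 1) *
      Complex.exp (-(w * τ) * p ^ 2) := by
    refine hint1.mono' ?_ (ae_of_all _ hbound)
    apply Measurable.aestronglyMeasurable
    fun_prop
  have hsplit : ∀ p : ℝ, (((√(1 + (p / 2) ^ 2))⁻¹ : ℝ) : ℂ) *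
      Complex.exp (-(w * τ * (2 + p ^ 2))) = Complex.exp (-(2 * w * τ)) *
      (((((√(1 + (p / 2) ^ 2))⁻¹ : ℝ) : ℂ) - 1) * Complex.exp (-(w * τ) * p ^ 2) +
        Complex.exp (-(w * τ) * p ^ 2)) := fun p => by
    rw [hfac]
    ring
  rw [integral_cexp_add_div_eq w hτ]
  simp_rw [hsplit]
  rw [integral_const_mul, integral_add hint2 hint0, integral_gaussian_complex hbc, ← mul_sub,
    add_sub_cancel_right, norm_mul]
  have hE : ‖Complex.exp (-(2 * w * τ))‖ = Real.exp (-(2 * w.re * τ)) := by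
    simp [Complex.norm_exp]
  rw [hE]
  gcongr
  refine (norm_integral_le_of_norm_le hint1 (ae_of_all _ hbound)).trans_eq ?_
  rw [integral_const_mul, integral_gaussian]
  congr 2
  field_simp

/-! ### Uniform gamma means of the error weight. -/

/-- A weight dominating the deviation of `√t` from `√N`. -/
noncomputable def gammaWeight (N t : ℝ) : ℝ :=
  1 + (t - N) ^ 2 / N + (t - N) ^ 2 / t + N / t

/-- The density exponent `m + 1 ≥ 1` leaves a nonnegative power of `t` after the divisions by `t` in
the weight, so everything reduces to gamma moments of rate `1 + l`. -/
theorem gamma_mul_weight_eq (m : ℕ) (l : ℝ) {t : ℝ} (ht : 0 < t) :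
    t ^ (m + 1) * Real.exp (-t) * (Real.exp (-(l * (t - (m + 2)))) * gammaWeight (m + 2) t) =
      Real.exp (l * (m + 2)) * (1 / (m + 2) * (t ^ (m + 3) * Real.exp (-((1 + l) * t))) -
        t ^ (m + 2) * Real.exp (-((1 + l) * t)) -
        (m + 1) * (t ^ (m + 1) * Real.exp (-((1 + l) * t))) +
        (m + 2) * (m + 3) * (t ^ m * Real.exp (-((1 + l) * t)))) := by
  have h : Real.exp (-t) * Real.exp (-(l * (t - (m + 2)))) =
      Real.exp (l * (m + 2)) * Real.exp (-((1 + l) * t)) := by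
    rw [← Real.exp_add, ← Real.exp_add]
    ring_nf
  have hm : (m : ℝ) + 2 ≠ 0 := by positivity
  have h2 : t ^ (m + 1) * gammaWeight (m + 2) t =
      1 / (m + 2) * t ^ (m + 3) - t ^ (m + 2) - (m + 1) * t ^ (m + 1) +
        (m + 2) * (m + 3) * t ^ m := by
    rw [gammaWeight]
    field_simp
    ring
  linear_combination t ^ (m + 1) * gammaWeight (m + 2) t * h +
    Real.exp (l * (m + 2)) * Real.exp (-((1 + l) * t)) * h2

theorem integrableOn_gamma_mul_weight (m : ℕ) {l : ℝ} (hl : 0 ≤ l) :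
    IntegrableOn (fun t : ℝ => t ^ (m + 1) * Real.exp (-t) *
      (Real.exp (-(l * (t - (m + 2)))) * gammaWeight (m + 2) t)) (Set.Ioi 0) := by
  have hI := fun k : ℕ => integrableOn_pow_mul_exp_neg_mul (b := 1 + l) (by linarith) k
  refine IntegrableOn.congr_fun (((((hI (m + 3)).const_mul (1 / ((m : ℝ) + 2))).sub (hI (m + 2))).sub
    ((hI (m + 1)).const_mul ((m : ℝ) + 1))).add
      ((hI m).const_mul (((m : ℝ) + 2) * (m + 3))) |>.const_mul (Real.exp (l * (m + 2))))
    (fun t ht => ?_) measurableSet_Ioi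
  exact (gamma_mul_weight_eq m l ht).symm

/-- From `log (1 + l) ≥ l / (1 + l) ≥ l - l²`. -/
theorem exp_mul_inv_one_add_pow_le (k : ℕ) {l : ℝ} (hl : 0 ≤ l) :
    Real.exp (l * k) / (1 + l) ^ k ≤ Real.exp (k * l ^ 2) := by
  have h1 : Real.exp l ≤ Real.exp (l ^ 2) * (1 + l) := by
    have h2 := Real.one_sub_inv_le_log_of_pos (x := 1 + l) (by linarith)
    have h3 : l - l ^ 2 ≤ 1 - (1 + l)⁻¹ := by
      have : 1 - (1 + l)⁻¹ - (l - l ^ 2) = l ^ 3 / (1 + l) := by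
        have : 1 + l ≠ 0 := by linarith
        field_simp
        ring
      have : 0 ≤ l ^ 3 / (1 + l) := by positivity
      linarith
    calc Real.exp l ≤ Real.exp (l ^ 2 + Real.log (1 + l)) := Real.exp_le_exp.mpr (by linarith)
      _ = _ := by rw [Real.exp_add, Real.exp_log (by linarith)]
  rw [div_le_iff₀ (by positivity), mul_comm l, Real.exp_nat_mul, Real.exp_nat_mul, ← mul_pow]
  gcongr

/-- The bound does not depend on `m`: a tilt `l` of order `1/√m` changes the density by a bounded
factor and shifts its mean by order `√m`, within the scale of the weight. -/
theorem integral_gamma_mul_weight_le (m : ℕ) {l c : ℝ} (hl : 0 ≤ l) (hlc : l ≤ c)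
    (hc : (m + 2) * l ^ 2 ≤ c ^ 2) :
    (∫ t in Set.Ioi (0 : ℝ), t ^ (m + 1) * Real.exp (-t) *
      (Real.exp (-(l * (t - (m + 2)))) * gammaWeight (m + 2) t)) / (m + 1).factorial ≤
      Real.exp (c ^ 2) * (2 * c ^ 2 + 4 * c + 6) := by
  have hb : 0 < 1 + l := by linarith
  have hI := fun k : ℕ => integrableOn_pow_mul_exp_neg_mul hb k
  rw [setIntegral_congr_fun measurableSet_Ioi fun t ht => gamma_mul_weight_eq m l ht,
    integral_const_mul, integral_add, integral_sub, integral_sub, integral_const_mul,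
    integral_const_mul, integral_const_mul, integral_pow_mul_exp_neg_mul hb,
    integral_pow_mul_exp_neg_mul hb, integral_pow_mul_exp_neg_mul hb,
    integral_pow_mul_exp_neg_mul hb]
  rotate_left
  · exact (hI (m + 3)).const_mul _
  · exact hI (m + 2)
  · exact ((hI (m + 3)).const_mul _).sub (hI (m + 2))
  · exact (hI (m + 1)).const_mul _
  · exact (((hI (m + 3)).const_mul _).sub (hI (m + 2))).sub ((hI (m + 1)).const_mul _)
  · exact (hI m).const_mul _
  have hf : (m.factorial : ℝ) ≠ 0 := by exact_mod_cast m.factorial_ne_zero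
  have hk := exp_mul_inv_one_add_pow_le (m + 2) hl
  push_cast at hk
  have h1 : Real.exp (l * (m + 2)) *
      (1 / (m + 2) * ((m + 3).factorial / (1 + l) ^ (m + 3 + 1)) -
        (m + 2).factorial / (1 + l) ^ (m + 2 + 1) -
        (m + 1) * ((m + 1).factorial / (1 + l) ^ (m + 1 + 1)) +
        (m + 2) * (m + 3) * (m.factorial / (1 + l) ^ (m + 1))) / (m + 1).factorial =
      Real.exp (l * (m + 2)) / (1 + l) ^ (m + 2) *
        (1 + ((m + 2) * (l / (1 + l)) ^ 2 + 1 / (1 + l) ^ 2) + ((m + 2) * l ^ 2 / (1 + l) +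
          2 * ((m + 2) / (m + 1)) * (1 + l))) := by
    simp only [Nat.factorial_succ]
    push_cast
    have : (m : ℝ) + 1 ≠ 0 := by positivity
    have : (m : ℝ) + 2 ≠ 0 := by positivity
    field_simp
    ring
  rw [h1]
  have h2 : ((m : ℝ) + 2) * (l / (1 + l)) ^ 2 ≤ c ^ 2 := by
    refine le_trans ?_ hc
    gcongr
    exact div_le_self hl (by linarith)
  have h3 : 1 / (1 + l) ^ 2 ≤ 1 := by
    rw [div_le_one (by positivity)]
    exact one_le_pow₀ (by linarith)
  have h4 : ((m : ℝ) + 2) * l ^ 2 / (1 + l) ≤ c ^ 2 :=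
    le_trans (div_le_self (by positivity) (by linarith)) hc
  have h5 : ((m : ℝ) + 2) / (m + 1) ≤ 2 := by
    rw [div_le_iff₀ (by positivity)]
    have : (0 : ℝ) ≤ m := m.cast_nonneg
    linarith
  have h6 : 2 * (((m : ℝ) + 2) / (m + 1)) * (1 + l) ≤ 2 * 2 * (1 + c) := by gcongr
  have h7 : Real.exp (l * (m + 2)) / (1 + l) ^ (m + 2) ≤ Real.exp (c ^ 2) :=
    hk.trans (Real.exp_le_exp.mpr hc)
  have h8 : 0 ≤ c := hl.trans hlc
  refine mul_le_mul h7 (by linarith) (by positivity) (by positivity)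

/-! ### Comparing the normalized Bessel kernel with an exponential. -/

theorem norm_cexp_sub_one_le_of_re_nonpos {z : ℂ} (hz : z.re ≤ 0) :
    ‖Complex.exp z - 1‖ ≤ ‖z‖ := by
  have h := Convex.norm_image_sub_le_of_norm_hasDerivWithin_le (𝕜 := ℂ) (f := Complex.exp)
    (f' := Complex.exp) (s := {z : ℂ | z.re ≤ 0}) (x := 0) (y := z) (C := 1)
    (fun x _ => (Complex.hasDerivAt_exp x).hasDerivWithinAt)
    (fun x hx => by
      rw [Complex.norm_exp, Real.exp_le_one_iff]
      exact hx) (convex_halfSpace_re_le 0) (by simp) hz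
  simpa using h

theorem norm_cexp_sub_cexp_le {z z' : ℂ} (h : z.re ≤ z'.re) :
    ‖Complex.exp z - Complex.exp z'‖ ≤ ‖z - z'‖ * Real.exp z'.re := by
  have h1 : Complex.exp z - Complex.exp z' = (Complex.exp (z - z') - 1) * Complex.exp z' := by
    rw [sub_mul, ← Complex.exp_add, sub_add_cancel, one_mul]
  rw [h1, norm_mul, Complex.norm_exp z']
  gcongr
  exact norm_cexp_sub_one_le_of_re_nonpos (by simpa using h)

theorem ofReal_mul_cpow {x : ℝ} (hx : 0 < x) {z : ℂ} (hz : z ≠ 0) (c : ℂ) :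
    ((x : ℂ) * z) ^ c = (x : ℂ) ^ c * z ^ c := by
  have hx0 : (x : ℂ) ≠ 0 := by exact_mod_cast hx.ne'
  rw [Complex.cpow_def_of_ne_zero (mul_ne_zero hx0 hz), Complex.cpow_def_of_ne_zero hx0,
    Complex.cpow_def_of_ne_zero hz, Complex.log_ofReal_mul hx hz, Complex.ofReal_log hx.le, add_mul,
    Complex.exp_add]

theorem ofReal_cpow_half {x : ℝ} (hx : 0 ≤ x) : (x : ℂ) ^ (1 / 2 : ℂ) = (√x : ℝ) := by
  rw [Real.sqrt_eq_rpow, Complex.ofReal_cpow hx]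
  norm_num

/-- As `w` is off the branch cut, the principal roots of `w` and `w⁻¹` cancel and only positive
factors remain. -/
theorem cpow_half_mul_cpow_half {w : ℂ} (hw : 0 < w.re) {x y : ℝ} (hx : 0 < x) (hy : 0 < y) :
    (w * x / Real.pi) ^ (1 / 2 : ℂ) * (Real.pi / (w * y)) ^ (1 / 2 : ℂ) = (√(x / y) : ℝ) := by
  have hw0 : w ≠ 0 := by
    rintro rfl
    simp at hw
  have harg : w.arg ≠ Real.pi := by
    intro h
    have := Complex.abs_arg_lt_pi_div_two_iff.mpr (Or.inl hw)
    rw [h, abs_of_pos Real.pi_pos] at this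
    linarith [Real.pi_pos]
  have h1 : w * x / Real.pi = ((x / Real.pi : ℝ) : ℂ) * w := by
    push_cast
    ring
  have h2 : Real.pi / (w * y) = ((Real.pi / y : ℝ) : ℂ) * w⁻¹ := by
    push_cast
    field_simp
  rw [h1, h2, ofReal_mul_cpow (by positivity) hw0, ofReal_mul_cpow (by positivity)
    (inv_ne_zero hw0), Complex.inv_cpow _ _ harg, ofReal_cpow_half (by positivity),
    ofReal_cpow_half (by positivity)]
  have h3 : w ^ (1 / 2 : ℂ) ≠ 0 := by simp [Complex.cpow_eq_zero_iff, hw0]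
  have h4 : √(x / y) = √(x / Real.pi) * √(Real.pi / y) := by
    rw [← Real.sqrt_mul (by positivity)]
    congr 1
    have := Real.pi_ne_zero
    field_simp
  rw [h4]
  push_cast
  field_simp

/-- The right side is exponential in `t = τ²` instead of `√t`, so its gamma mean is explicit; the
`1` covers `τ ≥ M`. -/
theorem exp_neg_two_mul_sub_le {r M τ : ℝ} (hr : 0 ≤ r) (hM : 0 < M) (hτ : 0 < τ) :
    Real.exp (-(2 * r * (τ - M))) ≤ 1 + Real.exp (-(2 * r / M * (τ ^ 2 - M ^ 2))) := by
  rcases le_total M τ with h | h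
  · have : Real.exp (-(2 * r * (τ - M))) ≤ 1 := by
      rw [Real.exp_le_one_iff, Left.neg_nonpos_iff]
      have := sub_nonneg.mpr h
      positivity
    linarith [Real.exp_pos (-(2 * r / M * (τ ^ 2 - M ^ 2)))]
  · have : Real.exp (-(2 * r * (τ - M))) ≤ Real.exp (-(2 * r / M * (τ ^ 2 - M ^ 2))) := by
      rw [Real.exp_le_exp, ← sub_nonneg]
      have : -(2 * r / M * (τ ^ 2 - M ^ 2)) - -(2 * r * (τ - M)) =
          2 * r * (M - τ) * τ / M := by
        field_simp
        ring
      rw [this]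
      have := sub_nonneg.mpr h
      positivity
    linarith

theorem sqrt_mul_self_le {ρ : ℝ} (hρ : 0 ≤ ρ) : √ρ * ρ ≤ 1 + ρ ^ 2 := by
  have h1 : √ρ ^ 2 = ρ := Real.sq_sqrt hρ
  have h2 : √ρ ≤ (1 + ρ) / 2 := by nlinarith [sq_nonneg (√ρ - 1)]
  calc √ρ * ρ ≤ (1 + ρ) / 2 * ρ := by gcongr
    _ ≤ 1 + ρ ^ 2 := by nlinarith [sq_nonneg (ρ - 1)]

theorem abs_sqrt_div_sub_one_le {M τ : ℝ} (hM : 0 < M) (hτ : 0 < τ) :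
    |√(M / τ) - 1| ≤ 1 / M * (((τ ^ 2 - M ^ 2) ^ 2 / τ ^ 2 + M ^ 2 / τ ^ 2) / 2) := by
  have h1 : |√(M / τ) - 1| ≤ |M / τ - 1| := by
    have h2 : √(M / τ) ^ 2 = M / τ := Real.sq_sqrt (by positivity)
    have h3 : M / τ - 1 = (√(M / τ) - 1) * (√(M / τ) + 1) := by linear_combination -h2
    rw [h3, abs_mul]
    refine le_mul_of_one_le_right (abs_nonneg _) ?_
    rw [abs_of_nonneg (by positivity)]
    linarith [Real.sqrt_nonneg (M / τ)]
  have h2 : |M / τ - 1| ≤ |τ ^ 2 - M ^ 2| / τ ^ 2 := by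
    have : τ ^ 2 - M ^ 2 = -((M / τ - 1) * (τ * (τ + M))) := by
      field_simp
      ring
    rw [this, abs_neg, abs_mul, abs_of_pos (by positivity : 0 < τ * (τ + M)),
      le_div_iff₀ (by positivity)]
    gcongr
    nlinarith
  refine h1.trans (h2.trans ?_)
  -- The arithmetic-geometric inequality `2M|δ| ≤ δ² + M²` with `δ = τ² - M²` produces terms of
  -- `gammaWeight`.
  have h3 : 1 / M * (((τ ^ 2 - M ^ 2) ^ 2 / τ ^ 2 + M ^ 2 / τ ^ 2) / 2) -
      |τ ^ 2 - M ^ 2| / τ ^ 2 = (|τ ^ 2 - M ^ 2| - M) ^ 2 / (2 * M * τ ^ 2) := by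
    rw [← sq_abs (τ ^ 2 - M ^ 2)]
    field_simp
    ring
  have : 0 ≤ (|τ ^ 2 - M ^ 2| - M) ^ 2 / (2 * M * τ ^ 2) := by positivity
  linarith

theorem sub_sq_le {M τ : ℝ} (hM : 0 < M) (hτ : 0 < τ) :
    (τ - M) ^ 2 ≤ (τ ^ 2 - M ^ 2) ^ 2 / M ^ 2 := by
  rw [le_div_iff₀ (by positivity), ← mul_pow, sq_le_sq, abs_mul, abs_of_pos hM]
  have : τ ^ 2 - M ^ 2 = (τ - M) * (τ + M) := by ring
  rw [this, abs_mul, abs_of_pos (by positivity : 0 < τ + M)]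
  gcongr
  linarith

/-- The normalized Bessel kernel is close to the exponential `t ↦ exp(-w(t - N)/√N)`. -/
theorem norm_normalized_bessel_sub_le {w : ℂ} (hw : 0 < w.re) {N t : ℝ} (hN : 0 < N) (ht : 0 < t) :
    ‖Complex.exp (2 * w * (√N : ℝ)) * (w * (√N : ℝ) / Real.pi) ^ (1 / 2 : ℂ) *
        (∫ s in Set.Ioi (0 : ℝ), Complex.exp (-(w * (s + t / s))) / s) -
      Complex.exp (-(w / (√N : ℝ) * (t - N)))‖ ≤
      (1 / (4 * w.re) * √(2 * ‖w‖ / w.re) + 1 + ‖w‖) / √N *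
        (1 + Real.exp (-(2 * w.re / √N * (t - N)))) * gammaWeight N t := by
  obtain ⟨M, hM, rfl⟩ : ∃ M : ℝ, 0 < M ∧ N = M ^ 2 :=
    ⟨√N, Real.sqrt_pos.mpr hN, (Real.sq_sqrt hN.le).symm⟩
  obtain ⟨τ, hτ, rfl⟩ : ∃ τ : ℝ, 0 < τ ∧ t = τ ^ 2 :=
    ⟨√t, Real.sqrt_pos.mpr ht, (Real.sq_sqrt ht.le).symm⟩
  rw [Real.sqrt_sq hM.le]
  set r := w.re with hr
  set G := ∫ s in Set.Ioi (0 : ℝ), Complex.exp (-(w * (s + (τ ^ 2 : ℝ) / s))) / s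
  set E := 1 + Real.exp (-(2 * r / M * (τ ^ 2 - M ^ 2)))
  have hEpos : 0 < E := by positivity
  have hexpE : Real.exp (-(2 * r * (τ - M))) ≤ E := exp_neg_two_mul_sub_le hw.le hM hτ
  have hw0 : 0 < ‖w‖ := hw.trans_le (Complex.re_le_norm w)
  set P := (w * M / Real.pi) ^ (1 / 2 : ℂ)
  have hP : ‖P‖ = √(‖w‖ * M / Real.pi) := by
    have := Complex.norm_cpow_real (w * M / Real.pi) (1 / 2)
    push_cast at this
    rw [this, ← Real.sqrt_eq_rpow, norm_div, norm_mul, Complex.norm_real, Complex.norm_real,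
      Real.norm_of_nonneg hM.le, Real.norm_of_nonneg Real.pi_pos.le]
  have hnE : ∀ x : ℝ, ‖Complex.exp (2 * w * x)‖ = Real.exp (2 * r * x) := fun x => by
    simp [Complex.norm_exp, hr]
  -- the error of the Bessel asymptotics
  have ha : ‖Complex.exp (2 * w * M) * P *
      (G - Complex.exp (-(2 * w * τ)) * (Real.pi / (w * τ)) ^ (1 / 2 : ℂ))‖ ≤
      1 / (4 * r) * √(2 * ‖w‖ / r) / M * E * (1 + M ^ 2 / τ ^ 2) := by
    rw [norm_mul, norm_mul, hnE, hP]
    refine (mul_le_mul_of_nonneg_left (norm_bessel_sub_le hw hτ) (by positivity)).trans ?_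
    rw [← hr]
    have e1 : Real.exp (2 * r * M) * Real.exp (-(2 * r * τ)) = Real.exp (-(2 * r * (τ - M))) := by
      rw [← Real.exp_add]
      ring_nf
    have e2 : √(‖w‖ * M / Real.pi) * √(2 * Real.pi / (r * τ)) = √(2 * ‖w‖ / r) * √(M / τ) := by
      rw [← Real.sqrt_mul (by positivity), ← Real.sqrt_mul (by positivity)]
      congr 1
      have := Real.pi_ne_zero
      field_simp
    have e3 : √(M / τ) * (M / τ) ≤ 1 + M ^ 2 / τ ^ 2 := by
      rw [← div_pow]
      exact sqrt_mul_self_le (by positivity)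
    calc Real.exp (2 * r * M) * √(‖w‖ * M / Real.pi) *
          (Real.exp (-(2 * r * τ)) * (1 / (4 * (r * τ)) * √(2 * Real.pi / (r * τ))))
        = (Real.exp (2 * r * M) * Real.exp (-(2 * r * τ))) *
          (√(‖w‖ * M / Real.pi) * √(2 * Real.pi / (r * τ))) * (1 / (4 * (r * τ))) := by ring
      _ = 1 / (4 * r) * √(2 * ‖w‖ / r) / M * Real.exp (-(2 * r * (τ - M))) *
          (√(M / τ) * (M / τ)) := by
          rw [e1, e2]
          field_simp
      _ ≤ _ := by gcongr
  -- replacing `√(M / τ)` by one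
  have hb : ‖Complex.exp (2 * w * M) * P *
      (Complex.exp (-(2 * w * τ)) * (Real.pi / (w * τ)) ^ (1 / 2 : ℂ)) -
      Complex.exp (-(2 * w * (τ - M)))‖ ≤
      1 / M * E * (((τ ^ 2 - M ^ 2) ^ 2 / τ ^ 2 + M ^ 2 / τ ^ 2) / 2) := by
    have e1 : Complex.exp (2 * w * M) * Complex.exp (-(2 * w * τ)) =
        Complex.exp (-(2 * w * (τ - M))) := by
      rw [← Complex.exp_add]
      ring_nf
    have e2 : Complex.exp (2 * w * M) * P *
        (Complex.exp (-(2 * w * τ)) * (Real.pi / (w * τ)) ^ (1 / 2 : ℂ)) -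
        Complex.exp (-(2 * w * (τ - M))) =
        Complex.exp (-(2 * w * (τ - M))) * ((√(M / τ) - 1 : ℝ) : ℂ) := by
      have := cpow_half_mul_cpow_half hw hM hτ
      push_cast
      rw [← this, ← e1]
      ring
    have e3 : ‖Complex.exp (-(2 * w * (τ - M)))‖ = Real.exp (-(2 * r * (τ - M))) := by
      rw [Complex.norm_exp, ← Complex.ofReal_sub]
      simp [hr]
    rw [e2, norm_mul, e3, Complex.norm_real, Real.norm_eq_abs]
    calc Real.exp (-(2 * r * (τ - M))) * |√(M / τ) - 1|
        ≤ E * (1 / M * (((τ ^ 2 - M ^ 2) ^ 2 / τ ^ 2 + M ^ 2 / τ ^ 2) / 2)) := by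
          gcongr
          exact abs_sqrt_div_sub_one_le hM hτ
      _ = _ := by ring
  -- linearizing the exponent
  have hc : ‖Complex.exp (-(2 * w * (τ - M))) - Complex.exp (-(w / M * ((τ ^ 2 : ℝ) - (M ^ 2 : ℝ))))‖ ≤
      ‖w‖ / M * E * ((τ ^ 2 - M ^ 2) ^ 2 / M ^ 2) := by
    have hM0 : (M : ℂ) ≠ 0 := by exact_mod_cast hM.ne'
    -- The linearized exponent differs by `-w(τ - M)²/M`, of nonpositive real part, so the
    -- unlinearized exponential controls the difference.
    have e1 : -(w / M * ((τ ^ 2 : ℝ) - (M ^ 2 : ℝ))) - -(2 * w * (τ - M)) =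
        w * ((-((τ - M) ^ 2 / M) : ℝ) : ℂ) := by
      push_cast
      field_simp
      ring
    have e2 : (-(2 * w * ((τ : ℂ) - M))).re = -(2 * r * (τ - M)) := by
      rw [← Complex.ofReal_sub]
      simp [hr]
    have hsq : 0 ≤ (τ - M) ^ 2 / M := by positivity
    have e3 : (-(w / M * ((τ ^ 2 : ℝ) - (M ^ 2 : ℝ)))).re ≤ (-(2 * w * ((τ : ℂ) - M))).re := by
      rw [← sub_nonpos, ← Complex.sub_re, e1, Complex.re_mul_ofReal]
      nlinarith
    rw [norm_sub_rev]
    refine (norm_cexp_sub_cexp_le e3).trans ?_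
    rw [e1, e2, norm_mul, Complex.norm_real, norm_neg, Real.norm_of_nonneg hsq]
    calc ‖w‖ * ((τ - M) ^ 2 / M) * Real.exp (-(2 * r * (τ - M)))
        ≤ ‖w‖ * ((τ ^ 2 - M ^ 2) ^ 2 / M ^ 2 / M) * E := by
          gcongr
          exact sub_sq_le hM hτ
      _ = _ := by ring
  have hsum : Complex.exp (2 * w * M) * P * G -
      Complex.exp (-(w / M * ((τ ^ 2 : ℝ) - (M ^ 2 : ℝ)))) =
      Complex.exp (2 * w * M) * P *
        (G - Complex.exp (-(2 * w * τ)) * (Real.pi / (w * τ)) ^ (1 / 2 : ℂ)) +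
      (Complex.exp (2 * w * M) * P *
        (Complex.exp (-(2 * w * τ)) * (Real.pi / (w * τ)) ^ (1 / 2 : ℂ)) -
        Complex.exp (-(2 * w * (τ - M)))) +
      (Complex.exp (-(2 * w * (τ - M))) -
        Complex.exp (-(w / M * ((τ ^ 2 : ℝ) - (M ^ 2 : ℝ))))) := by ring
  rw [hsum]
  refine (norm_add₃_le.trans (add_le_add (add_le_add ha hb) hc)).trans ?_
  have q1 : 0 ≤ (τ ^ 2 - M ^ 2) ^ 2 / τ ^ 2 := by positivity
  have q2 : 0 ≤ M ^ 2 / τ ^ 2 := by positivity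
  have q3 : 0 ≤ (τ ^ 2 - M ^ 2) ^ 2 / M ^ 2 := by positivity
  calc _ ≤ 1 / (4 * r) * √(2 * ‖w‖ / r) / M * E * gammaWeight (M ^ 2) (τ ^ 2) +
        1 / M * E * gammaWeight (M ^ 2) (τ ^ 2) +
        ‖w‖ / M * E * gammaWeight (M ^ 2) (τ ^ 2) := by
        unfold gammaWeight
        gcongr <;> linarith
    _ = _ := by ring

/-! ### The gamma mean of the limiting exponential. -/

/-- To second order, `N log(1 + w/√N) = w√N - w²/2 + O(1/√N)`. -/
theorem isBigO_cexp_div_one_add_pow_sub (w : ℂ) :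
    (fun n : ℕ => Complex.exp (w * (√((n : ℝ) + 1) : ℝ)) /
      (1 + w / (√((n : ℝ) + 1) : ℝ)) ^ (n + 1) - Complex.exp (w ^ 2 / 2)) =O[atTop]
      fun n : ℕ => 1 / √((n : ℝ) + 1) := by
  have hM : Tendsto (fun n : ℕ => √((n : ℝ) + 1)) atTop atTop :=
    Real.tendsto_sqrt_atTop.comp
      (tendsto_atTop_add_const_right _ _ tendsto_natCast_atTop_atTop)
  refine IsBigO.of_bound (‖Complex.exp (w ^ 2 / 2)‖ * (2 * ‖w‖ ^ 3)) ?_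
  -- The first threshold gives `‖x‖ ≤ 1/2` for the logarithm series; the second keeps the remaining
  -- exponent of norm at most `1`.
  filter_upwards [hM.eventually_ge_atTop (2 * ‖w‖), hM.eventually_ge_atTop (‖w‖ ^ 3)] with n h1 h2
  have hMpos : 0 < √((n : ℝ) + 1) := by positivity
  have hsq : √((n : ℝ) + 1) ^ 2 = n + 1 := Real.sq_sqrt (by positivity)
  set M := √((n : ℝ) + 1)
  have hM0 : (M : ℂ) ≠ 0 := by exact_mod_cast hMpos.ne'
  have hsqc : (M : ℂ) ^ 2 = n + 1 := by exact_mod_cast hsq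
  set x : ℂ := w / M with hx
  have hxn : ‖x‖ = ‖w‖ / M := by
    rw [hx, norm_div, Complex.norm_real, Real.norm_of_nonneg hMpos.le]
  have hx2 : ‖x‖ ≤ 1 / 2 := by
    rw [hxn, div_le_iff₀ hMpos]
    linarith
  have hx1 : 1 + x ≠ 0 := by
    intro h
    have : x = -1 := by linear_combination h
    rw [this] at hx2
    norm_num at hx2
  set R : ℂ := Complex.log (1 + x) - (x - x ^ 2 / 2) with hR
  have hRn : ‖R‖ ≤ ‖x‖ ^ 3 := by
    have h := Complex.norm_log_sub_logTaylor_le 2 (z := x) (by linarith)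
    have ht : Complex.logTaylor 3 x = x - x ^ 2 / 2 := by
      simp [Complex.logTaylor, Finset.sum_range_succ]
      ring
    rw [ht] at h
    refine h.trans ?_
    have h3 : (1 - ‖x‖)⁻¹ ≤ 2 := by
      rw [inv_le_comm₀ (by linarith) (by norm_num)]
      linarith
    rw [div_le_iff₀ (by norm_num)]
    calc ‖x‖ ^ (2 + 1) * (1 - ‖x‖)⁻¹ ≤ ‖x‖ ^ (2 + 1) * 2 := by gcongr
      _ ≤ ‖x‖ ^ 3 * ((2 : ℕ) + 1) := by
        push_cast
        gcongr
        norm_num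
  have hNR : ‖-((M : ℂ) ^ 2 * R)‖ ≤ ‖w‖ ^ 3 / M := by
    rw [norm_neg, norm_mul, norm_pow, Complex.norm_real, Real.norm_of_nonneg hMpos.le]
    calc M ^ 2 * ‖R‖ ≤ M ^ 2 * ‖x‖ ^ 3 := by gcongr
      _ = _ := by
        rw [hxn]
        field_simp
  have hpow : (1 + x) ^ (n + 1) = Complex.exp ((M : ℂ) ^ 2 * Complex.log (1 + x)) := by
    conv_lhs => rw [← Complex.exp_log hx1]
    rw [← Complex.exp_nat_mul, hsqc]
    push_cast
    rfl
  have hquot : Complex.exp (w * M) / (1 + x) ^ (n + 1) - Complex.exp (w ^ 2 / 2) =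
      Complex.exp (w ^ 2 / 2) * (Complex.exp (-((M : ℂ) ^ 2 * R)) - 1) := by
    rw [hpow, ← Complex.exp_sub, mul_sub, ← Complex.exp_add, mul_one]
    congr 2
    rw [hR, hx]
    field_simp
    ring
  rw [hquot, norm_mul, Real.norm_of_nonneg (by positivity), mul_assoc]
  gcongr
  have h3 : ‖w‖ ^ 3 / M ≤ 1 := (div_le_one hMpos).mpr h2
  refine (Complex.norm_exp_sub_one_le (hNR.trans h3)).trans ?_
  calc 2 * ‖-((M : ℂ) ^ 2 * R)‖ ≤ 2 * (‖w‖ ^ 3 / M) := by gcongr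
    _ = _ := by ring

theorem integral_gamma_mul_cexp (n : ℕ) {w : ℂ} (hw : 0 < w.re) :
    (∫ t in Set.Ioi (0 : ℝ), ((t ^ n * Real.exp (-t) : ℝ) : ℂ) *
      Complex.exp (-(w / (√((n : ℝ) + 1) : ℝ) * (t - ((n : ℝ) + 1 : ℝ))))) / n.factorial =
      Complex.exp (w * (√((n : ℝ) + 1) : ℝ)) / (1 + w / (√((n : ℝ) + 1) : ℝ)) ^ (n + 1) := by
  have hMpos : 0 < √((n : ℝ) + 1) := by positivity
  have hsq : √((n : ℝ) + 1) ^ 2 = n + 1 := Real.sq_sqrt (by positivity)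
  set M := √((n : ℝ) + 1)
  have hM0 : (M : ℂ) ≠ 0 := by exact_mod_cast hMpos.ne'
  have hb : 0 < (1 + w / M).re := by
    rw [Complex.add_re, Complex.div_ofReal_re, Complex.one_re]
    positivity
  have h : ∀ t : ℝ, ((t ^ n * Real.exp (-t) : ℝ) : ℂ) *
      Complex.exp (-(w / M * (t - ((n : ℝ) + 1 : ℝ)))) =
      Complex.exp (w * M) * ((t : ℂ) ^ n * Complex.exp (-((1 + w / M) * t))) := by
    intro t
    have : Complex.exp (-t) * Complex.exp (-(w / M * (t - ((n : ℝ) + 1 : ℝ)))) =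
        Complex.exp (w * M) * Complex.exp (-((1 + w / M) * t)) := by
      rw [← Complex.exp_add, ← Complex.exp_add, ← hsq]
      congr 1
      push_cast
      field_simp
      ring
    push_cast at this ⊢
    linear_combination (t : ℂ) ^ n * this
  have hn : (n.factorial : ℂ) ≠ 0 := by exact_mod_cast n.factorial_ne_zero
  simp_rw [h]
  rw [integral_const_mul, integral_pow_mul_cexp_neg_mul hb]
  field_simp

theorem integrableOn_gamma_mul_cexp (n : ℕ) {w : ℂ} (hw : 0 < w.re) {M : ℝ} (hM : 0 < M) (c : ℂ) :
    IntegrableOn (fun t : ℝ => ((t ^ n * Real.exp (-t) : ℝ) : ℂ) *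
      Complex.exp (-(w / M * (t - c)))) (Set.Ioi 0) := by
  have hb : 0 < (1 + w / M).re := by
    rw [Complex.add_re, Complex.div_ofReal_re, Complex.one_re]
    positivity
  refine ((integrableOn_pow_mul_cexp_neg_mul hb n).const_mul (Complex.exp (w / M * c))).congr
    (ae_of_all _ fun t => ?_)
  have : Complex.exp (w / M * c) * Complex.exp (-((1 + w / M) * t)) =
      Complex.exp (-t) * Complex.exp (-(w / M * (t - c))) := by
    rw [← Complex.exp_add, ← Complex.exp_add]
    ring_nf
  push_cast
  linear_combination (t : ℂ) ^ n * this

/-! ### Assembling the asymptotics. -/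

theorem norm_normalized_integral_sub_le (m : ℕ) {w : ℂ} (hw : 0 < w.re) :
    ‖Complex.exp (2 * w * (√((m : ℝ) + 2) : ℝ)) *
        (w * (√((m : ℝ) + 2) : ℝ) / Real.pi) ^ (1 / 2 : ℂ) *
        ((∫ t in Set.Ioi (0 : ℝ), ((t ^ (m + 1) * Real.exp (-t) : ℝ) : ℂ) *
          ∫ s in Set.Ioi (0 : ℝ), Complex.exp (-(w * (s + t / s))) / s) / (m + 1).factorial) -
      (∫ t in Set.Ioi (0 : ℝ), ((t ^ (m + 1) * Real.exp (-t) : ℝ) : ℂ) *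
        Complex.exp (-(w / (√((m : ℝ) + 2) : ℝ) * (t - ((m : ℝ) + 2 : ℝ))))) /
          (m + 1).factorial‖ ≤
      (1 / (4 * w.re) * √(2 * ‖w‖ / w.re) + 1 + ‖w‖) *
        (6 + Real.exp ((2 * w.re) ^ 2) * (2 * (2 * w.re) ^ 2 + 4 * (2 * w.re) + 6)) *
        (1 / √((m : ℝ) + 2)) := by
  have hMpos : 0 < √((m : ℝ) + 2) := by positivity
  have hsq : √((m : ℝ) + 2) ^ 2 = m + 2 := Real.sq_sqrt (by positivity)
  set M := √((m : ℝ) + 2) with hM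
  set D : ℂ := Complex.exp (2 * w * M) * (w * M / Real.pi) ^ (1 / 2 : ℂ)
  set C := 1 / (4 * w.re) * √(2 * ‖w‖ / w.re) + 1 + ‖w‖
  have hC : 0 < C := by positivity
  set l := 2 * w.re / M with hl
  have hl0 : 0 ≤ l := by positivity
  have hM1 : 1 ≤ M := Real.one_le_sqrt.mpr (by
    have : (0 : ℝ) ≤ m := m.cast_nonneg
    linarith)
  have hi1 := (integrableOn_pow_mul_exp_neg_mul_bessel (m + 1) hw).const_mul D
  have hi2 := integrableOn_gamma_mul_cexp (m + 1) hw hMpos (((m : ℝ) + 2 : ℝ) : ℂ)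
  have hw0 := integrableOn_gamma_mul_weight m le_rfl
  have hwl := integrableOn_gamma_mul_weight m hl0
  -- The untilted weight (`l = c = 0`) contributes the constant `6`; the tilted one has `c = 2 Re
  -- w`.
  have hb0 := integral_gamma_mul_weight_le m (le_refl 0) (le_refl 0) (by simp)
  have hbl := integral_gamma_mul_weight_le m hl0 (c := 2 * w.re)
    (div_le_self (by positivity) hM1) (by
      rw [← hsq, hl, div_pow]
      exact (mul_div_cancel₀ _ (by positivity)).le)
  have hf : (0 : ℝ) < (m + 1).factorial := by exact_mod_cast (m + 1).factorial_pos
  rw [mul_div_assoc', ← integral_const_mul, ← sub_div, ← integral_sub hi1 hi2, norm_div,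
    Complex.norm_natCast]
  have hbound : ∀ t ∈ Set.Ioi (0 : ℝ),
      ‖D * (((t ^ (m + 1) * Real.exp (-t) : ℝ) : ℂ) *
        ∫ s in Set.Ioi (0 : ℝ), Complex.exp (-(w * (s + t / s))) / s) -
      ((t ^ (m + 1) * Real.exp (-t) : ℝ) : ℂ) *
        Complex.exp (-(w / M * (t - ((m : ℝ) + 2 : ℝ))))‖ ≤
      C / M * (t ^ (m + 1) * Real.exp (-t) *
          (Real.exp (-(0 * (t - (m + 2)))) * gammaWeight (m + 2) t) +
        t ^ (m + 1) * Real.exp (-t) *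
          (Real.exp (-(l * (t - (m + 2)))) * gammaWeight (m + 2) t)) := by
    intro t ht
    have ht' : 0 < t := ht
    have h := norm_normalized_bessel_sub_le hw (N := (m : ℝ) + 2) (by positivity) ht'
    rw [← hM] at h
    rw [mul_left_comm, ← mul_sub, norm_mul, Complex.norm_real, Real.norm_of_nonneg (by positivity)]
    calc _ ≤ t ^ (m + 1) * Real.exp (-t) *
        (C / M * (1 + Real.exp (-(l * (t - (m + 2))))) * gammaWeight (m + 2) t) := by
          gcongr
      _ = _ := by
          rw [zero_mul, neg_zero, Real.exp_zero]
          ring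
  have h1 := norm_integral_le_of_norm_le ((hw0.add hwl).const_mul (C / M))
    ((ae_restrict_mem measurableSet_Ioi).mono hbound)
  rw [integral_const_mul] at h1
  simp only [Pi.add_apply] at h1
  rw [integral_add hw0 hwl] at h1
  refine (div_le_div_of_nonneg_right h1 hf.le).trans ?_
  rw [mul_div_assoc]
  refine (mul_le_mul_of_nonneg_left ((add_div _ _ _).trans_le (add_le_add hb0 hbl))
    (by positivity)).trans_eq ?_
  norm_num
  ring

theorem laguerreAlpha_one_eq_bessel (n : ℕ) {a w : ℂ} (hw : 0 < w.re) (hwa : w ^ 2 = 2 * a) :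
    laguerreAlpha n 1 a = (∫ t in Set.Ioi (0 : ℝ), ((t ^ n * Real.exp (-t) : ℝ) : ℂ) *
        ∫ s in Set.Ioi (0 : ℝ), Complex.exp (-(w * (s + t / s))) / s) / n.factorial := by
  rw [laguerreAlpha_one_eq, ← hwa, integral_exp_neg_mul_laguerreL_div n hw,
    integral_cexp_mul_pow_div n hw]

theorem isBigO_normalized_laguerreAlpha_sub {a w : ℂ} (hw : 0 < w.re) (hwa : w ^ 2 = 2 * a) :
    (fun n : ℕ => Complex.exp (2 * w * (√((n : ℝ) + 1) : ℝ)) *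
      (w * (√((n : ℝ) + 1) : ℝ) / Real.pi) ^ (1 / 2 : ℂ) * laguerreAlpha n 1 a -
      Complex.exp a) =O[atTop] fun n : ℕ => 1 / √((n : ℝ) + 1) := by
  have h1 : (fun n : ℕ => Complex.exp (2 * w * (√((n : ℝ) + 1) : ℝ)) *
      (w * (√((n : ℝ) + 1) : ℝ) / Real.pi) ^ (1 / 2 : ℂ) * laguerreAlpha n 1 a -
      Complex.exp (w * (√((n : ℝ) + 1) : ℝ)) / (1 + w / (√((n : ℝ) + 1) : ℝ)) ^ (n + 1))
      =O[atTop] fun n : ℕ => 1 / √((n : ℝ) + 1) := by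
    refine IsBigO.of_bound ((1 / (4 * w.re) * √(2 * ‖w‖ / w.re) + 1 + ‖w‖) *
      (6 + Real.exp ((2 * w.re) ^ 2) * (2 * (2 * w.re) ^ 2 + 4 * (2 * w.re) + 6))) ?_
    -- The weight estimate needs `n = m + 1`.
    filter_upwards [eventually_ge_atTop 1] with n hn
    obtain ⟨m, rfl⟩ := Nat.exists_eq_add_of_le' hn
    have h := norm_normalized_integral_sub_le m hw
    have hm : (m : ℝ) + 2 = ((m + 1 : ℕ) : ℝ) + 1 := by
      push_cast
      ring
    rw [hm, integral_gamma_mul_cexp (m + 1) hw, ← laguerreAlpha_one_eq_bessel (m + 1) hw hwa] at h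
    rwa [Real.norm_of_nonneg (by positivity)]
  refine (h1.add (isBigO_cexp_div_one_add_pow_sub w)).congr_left fun n => ?_
  rw [hwa, mul_div_cancel_left₀ _ two_ne_zero]
  ring

theorem cpow_half_re_pos {z : ℂ} (hz : ¬ (z.im = 0 ∧ z.re ≤ 0)) : 0 < (z ^ (1 / 2 : ℂ)).re := by
  have hz0 : z ≠ 0 := by
    rintro rfl
    simp at hz
  have harg : |z.arg| < Real.pi := by
    refine lt_of_le_of_ne (Complex.abs_arg_le_pi z) fun h => hz ?_
    have h2 : z.arg = Real.pi := by
      rcases abs_eq Real.pi_pos.le |>.mp h with h | h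
      · exact h
      · linarith [Complex.neg_pi_lt_arg z]
    rw [Complex.arg_eq_pi_iff] at h2
    exact ⟨h2.2, h2.1.le⟩
  have h1 : Complex.log z * (1 / 2) = Complex.log z * ((1 / 2 : ℝ) : ℂ) := by
    push_cast
    rfl
  rw [Complex.cpow_def_of_ne_zero hz0, h1, Complex.exp_re, Complex.im_mul_ofReal, Complex.log_im]
  rw [abs_lt] at harg
  exact mul_pos (Real.exp_pos _) (Real.cos_pos_of_mem_Ioo ⟨by linarith, by linarith⟩)

/-- Halving the principal argument keeps it in `(-π, π]`, so no branch is crossed. -/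
theorem cpow_half_cpow_half (z : ℂ) : (z ^ (1 / 2 : ℂ)) ^ (1 / 2 : ℂ) = z ^ (1 / 4 : ℂ) := by
  have him : (Complex.log z * (1 / 2)).im = z.arg / 2 := by
    have h1 : Complex.log z * (1 / 2) = Complex.log z * ((1 / 2 : ℝ) : ℂ) := by
      push_cast
      rfl
    rw [h1, Complex.im_mul_ofReal, Complex.log_im]
    ring
  have h1 := Complex.neg_pi_lt_arg z
  have h2 := Complex.arg_le_pi z
  have h3 := Real.pi_pos
  rw [← Complex.cpow_mul _ (by rw [him]; linarith) (by rw [him]; linarith)]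
  norm_num

theorem mainTheorem5 (a : ℂ) (ha : ¬ (a.im = 0 ∧ a.re ≤ 0)) :
    ∃ ε : ℕ → ℂ,
      (ε =O[atTop] fun n : ℕ => 1 / Real.sqrt ((n : ℝ) + 1)) ∧
      ∀ n : ℕ,
        laguerreAlpha n 1 a =
          Complex.exp (a - 2 * (2 * a * ((n : ℂ) + 1)) ^ (1 / 2 : ℂ)) *
            ((Real.sqrt Real.pi : ℂ) / (2 * a * ((n : ℂ) + 1)) ^ (1 / 4 : ℂ)) *
            (1 + ε n) := by
  have ha0 : a ≠ 0 := by
    rintro rfl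
    simp at ha
  have h2a0 : 2 * a ≠ 0 := mul_ne_zero two_ne_zero ha0
  obtain ⟨w, hw_def⟩ : ∃ w : ℂ, w = (2 * a) ^ (1 / 2 : ℂ) := ⟨_, rfl⟩
  have hw : 0 < w.re := by
    rw [hw_def]
    refine cpow_half_re_pos fun h => ha ?_
    have h' : a.im = 0 ∧ 2 * a.re ≤ 0 := by simpa using h
    exact ⟨h'.1, by linarith [h'.2]⟩
  have hwa : w ^ 2 = 2 * a := by
    rw [hw_def, ← Complex.cpow_nat_mul]
    norm_num
  -- `ε n` is the exact relative error, so the identity holds for every `n`, and only its decay is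
  -- asymptotic.
  refine ⟨fun n => Complex.exp (-a) * (Complex.exp (2 * w * (√((n : ℝ) + 1) : ℝ)) *
    (w * (√((n : ℝ) + 1) : ℝ) / Real.pi) ^ (1 / 2 : ℂ) * laguerreAlpha n 1 a - Complex.exp a),
    (isBigO_normalized_laguerreAlpha_sub hw hwa).const_mul_left _, fun n => ?_⟩
  have hN : (0 : ℝ) < n + 1 := by positivity
  have hMpos : 0 < √((n : ℝ) + 1) := by positivity
  have hroot : (2 * a * ((n : ℂ) + 1)) ^ (1 / 2 : ℂ) = (√((n : ℝ) + 1) : ℝ) * w := by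
    have h := ofReal_mul_cpow hN h2a0 (1 / 2)
    rw [ofReal_cpow_half hN.le, ← hw_def] at h
    rw [← h, mul_comm]
    push_cast
    rfl
  rw [← cpow_half_cpow_half, hroot]
  beta_reduce
  set M := √((n : ℝ) + 1)
  have hM0 : (M : ℂ) ≠ 0 := by exact_mod_cast hMpos.ne'
  have hw0 : w ≠ 0 := by
    rintro rfl
    simp at hw
  have hP : (w * M / Real.pi) ^ (1 / 2 : ℂ) = (M * w) ^ (1 / 2 : ℂ) / (√Real.pi : ℝ) := by
    have h1 : w * M / Real.pi = ((Real.pi⁻¹ : ℝ) : ℂ) * (M * w) := by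
      push_cast
      ring
    rw [h1, ofReal_mul_cpow (by positivity) (mul_ne_zero hM0 hw0), ofReal_cpow_half (by positivity),
      Real.sqrt_inv]
    push_cast
    ring
  have hQ : ((M : ℂ) * w) ^ (1 / 2 : ℂ) ≠ 0 := by simp [Complex.cpow_eq_zero_iff, hM0, hw0]
  have hpi : ((√Real.pi : ℝ) : ℂ) ≠ 0 := by
    exact_mod_cast (Real.sqrt_pos.mpr Real.pi_pos).ne'
  have hE : Complex.exp (a - 2 * (M * w)) = Complex.exp a * (Complex.exp (2 * w * M))⁻¹ := by
    rw [← Complex.exp_neg, ← Complex.exp_add]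
    ring_nf
  have hE1 := Complex.exp_ne_zero (2 * w * M)
  have hE2 := Complex.exp_ne_zero a
  rw [hP, hE, Complex.exp_neg a]
  field_simp
  ring
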